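/- Let $d\ge 1$ and let $\mu$ be a Borel probability measure on $\mathbb{R}^d$ with finite second moment. A \emph{measure field} over $\mu$ is a Borel probability measure $\xi=\xi(dx,dv)$ on $\mathbb{R}^d\times\mathbb{R}^d$ with finite second moment and first marginal $\mu$. It is \emph{centred} if its barycenter is $0$, i.e. $\int\varphi\,d\xi=0$ for every continuous $\varphi:\mathbb{R}^d\times\mathbb{R}^d\to\mathbb{R}$ of at most quadratic growth that is linear in $v$. For measure fields $\xi,\zeta$ over $\mu$, let $\Gamma_\mu(\xi,\zeta)$ be the set of Borel probability measures $\alpha=\alpha(dx,dv,dw)$ on $(\mathbb{R}^d)^3$ with finite second moment whose $(x,v)$-marginal is $\xi$ and whose $(x,w)$-marginal is $\zeta$, and let $$W_\mu(\xi,\zeta)=\Big(\inf_{\alpha\in\Gamma_\mu(\xi,\zeta)}\int|v-w|^2\,d\alpha\Big)^{1/2}.$$ A \emph{Grassmannian section} is a map $D$ assigning to each $x\in\mathbb{R}^d$ a linear subspace $D(x)\subset\mathbb{R}^d$ (possibly $\{0\}$) such that $\{x: D(x)\cap O\neq\emptyset\}$ is Borel for every open $O\subset\mathbb{R}^d$;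 its graph is $\operatorname{graph}D=\{(x,v): v\in D(x)\}$. Let $S$ be a nonempty set of centred measure fields over $\mu$ such that 1. $S$ is closed with respect to $W_\mu$ in the space of measure fields over $\mu$; 2. $S$ is horizontally convex: for all $\xi,\zeta\in S$, $\alpha\in\Gamma_\mu(\xi,\zeta)$ and $\lambda\in[0,1]$, the image of $\alpha$ under $(x,v,w)\mapsto(x,(1-\lambda)v+\lambda w)$ belongs to $S$; 3. $S$ is a positive cone: for all $\xi\in S$ and $\lambda\ge 0$, the image of $\xi$ under $(x,v)\mapsto(x,\lambda v)$ belongs to $S$. Then there exists a Grassmannian section $D$ such that, for every Borel measure $\xi$ on $\mathbb{R}^d\times\mathbb{R}^d$, $$\xi\in S\iff \xi \text{ is a centred measure field over } \mu \text{ and } \xi(\operatorname{graph}D)=1.$$ -/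

import Mathlib

open MeasureTheory Filter Topology
open scoped ENNReal

namespace MeasureField

/-- The space `ℝ^d` with its Euclidean norm. -/
abbrev Pt (d : ℕ) : Type := EuclideanSpace ℝ (Fin d)

/-- The tangent bundle of `ℝ^d`: pairs `(x, v)`. -/
abbrev TBundle (d : ℕ) : Type := Pt d × Pt d

/-- Triples `(x, v, w)`: a point and two tangent vectors at it. -/
abbrev TBundle2 (d : ℕ) : Type := Pt d × Pt d × Pt d

/-- Borel probability measures on `ℝ^d` with finite second moment. -/
def P2 (d : ℕ) : Set (Measure (Pt d)) :=
  {μ | IsProbabilityMeasure μ ∧ ∫⁻ x, ‖x‖ₑ ^ 2 ∂μ < ∞}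

variable {d : ℕ}

/-- Measure fields over `μ`: Borel probability measures on the tangent bundle with finite second
moment and first marginal `μ`. -/
def fields (μ : Measure (Pt d)) : Set (Measure (TBundle d)) :=
  {ξ | IsProbabilityMeasure ξ ∧ ∫⁻ p, (‖p.1‖ₑ ^ 2 + ‖p.2‖ₑ ^ 2) ∂ξ < ∞ ∧
    ξ.map Prod.fst = μ}

/-- Plans between two fields that only couple vectors attached to the same point: Borel
probability measures on triples `(x, v, w)` with finite second moment, whose `(x, v)`-marginal is
`ξ` and whose `(x, w)`-marginal is `ζ`. -/
def plans (ξ ζ : Measure (TBundle d)) : Set (Measure (TBundle2 d)) :=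
  {α | IsProbabilityMeasure α ∧
    ∫⁻ t, (‖t.1‖ₑ ^ 2 + ‖t.2.1‖ₑ ^ 2 + ‖t.2.2‖ₑ ^ 2) ∂α < ∞ ∧
    α.map (fun t => (t.1, t.2.1)) = ξ ∧ α.map (fun t => (t.1, t.2.2)) = ζ}

/-- The distance `W_μ` between two fields `ξ` and `ζ` over `μ`, with values in `[0, ∞]`
(it is finite on fields over a common `μ`, and `μ` is the common first marginal). -/
noncomputable def W (ξ ζ : Measure (TBundle d)) : ℝ≥0∞ :=
  (⨅ α ∈ plans ξ ζ, ∫⁻ t, ‖t.2.1 - t.2.2‖ₑ ^ 2 ∂α) ^ (1 / 2 : ℝ)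

/-- `b ∈ L²_μ` is the barycenter of the field `ξ`: `∫ φ(x,v) dξ = ∫ φ(x,b(x)) dμ` for every
continuous `φ` of at most quadratic growth that is linear in `v`. -/
def IsBarycenter (μ : Measure (Pt d)) (ξ : Measure (TBundle d)) (b : Pt d → Pt d) : Prop :=
  MemLp b 2 μ ∧
    ∀ φ : TBundle d → ℝ, Continuous φ →
      (∃ C : ℝ, ∀ p, |φ p| ≤ C * (1 + ‖p.1‖ ^ 2 + ‖p.2‖ ^ 2)) →
      (∀ x, IsLinearMap ℝ (fun v => φ (x, v))) →
      ∫ p, φ p ∂ξ = ∫ x, φ (x, b x) ∂μ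

/-- Centred fields over `μ`: those with barycenter `0`. -/
def centredFields (μ : Measure (Pt d)) : Set (Measure (TBundle d)) :=
  {ξ | ξ ∈ fields μ ∧ IsBarycenter μ ξ (fun _ => 0)}

/-- The rescaled field `r · ξ`, i.e. the image of `ξ` under `(x, v) ↦ (x, r v)`. -/
noncomputable def scale (r : ℝ) (ξ : Measure (TBundle d)) : Measure (TBundle d) :=
  ξ.map (fun p => (p.1, r • p.2))

/-- Positive cones of fields. -/
def IsCone (S : Set (Measure (TBundle d))) : Prop :=
  ∀ ξ ∈ S, ∀ r : ℝ, 0 ≤ r → scale r ξ ∈ S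

/-- Horizontal convexity: stability under interpolation along every plan in `plans ξ ζ`. -/
def IsHorizontallyConvex (S : Set (Measure (TBundle d))) : Prop :=
  ∀ r : ℝ, 0 ≤ r → r ≤ 1 → ∀ ξ ∈ S, ∀ ζ ∈ S, ∀ α ∈ plans ξ ζ,
    α.map (fun t => (t.1, (1 - r) • t.2.1 + r • t.2.2)) ∈ S

/-- `W_μ`-closedness of a subset of the metric space of fields over `μ` (by sequences). -/
def IsWClosed (μ : Measure (Pt d)) (S : Set (Measure (TBundle d))) : Prop :=
  ∀ (ζ : ℕ → Measure (TBundle d)) (ξ : Measure (TBundle d)), (∀ n, ζ n ∈ S) → ξ ∈ fields μ →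
    Tendsto (fun n => W (ζ n) ξ) atTop (𝓝 0) → ξ ∈ S

/-- Grassmannian sections: measurable set-valued maps whose values are linear subspaces. -/
def IsGrassmannianSection (D : Pt d → Submodule ℝ (Pt d)) : Prop :=
  ∀ O : Set (Pt d), IsOpen O → MeasurableSet {x | ((D x : Set (Pt d)) ∩ O).Nonempty}

/-- The graph `{(x, v) : v ∈ D(x)}`. -/
def graph (D : Pt d → Submodule ℝ (Pt d)) : Set (TBundle d) :=
  {p | p.2 ∈ D p.1}

end MeasureField

/-!
A field over `μ` is the law of `(x, v (x, u))`, where `x` has law `μ`, `u` is uniform on `[0, 1]` and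
independent of `x`, and `v` is measurable (`exists_map_prod_unitInterval_eq`). Read through such
representations, horizontal convexity, the cone property and `W_μ`-closedness say that random
vectors with law in `S` form a closed convex cone of an `L²` space, whatever the probability space
carrying them.

The section `D` is spanned at `x` by the columns `∫ v_i(x, u) v(x, u) du` of the fibrewise second
moment matrices of the `v` from a countable `L²`-dense set of representatives of elements of `S`.
Since a square-integrable vector almost surely lies in the range of its second moment matrix
(`ae_mem_span_integral_coord_smul`), every element of `S` is concentrated on the graph of `D`.

Conversely let `ζ` be a centred field concentrated on the graph of `D`. Projecting in
`L²(ζ ⊗ du)` yields a plan between `ζ` and an element of `S`, realized by random vectors `w` and `π`,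
whose cost `∫ |w - π|²` is minimal among all plans between `ζ` and elements of `S`
(`exists_optimal_plan`). Minimality gives `∫ ⟨w - π, V⟩ ≤ 0` for every `V` with law in `S`, however it
is coupled to `r = w - π` above the same `x`. The coupling is now chosen as follows. Take copies
`r₁, r₂` of `r` and `v₁, v₂` of some `v` with law in `S`, all independent given `x`, and couple `r₁`
with the partner it receives in the pairing of `{r₁, r₂}` with `{v₁, v₂}` that has the larger sum of
inner products. The partner still has the law of `v`, and as everything is centred, the integral
of the inner product is a positive multiple of `∫ |⟨r₁ - r₂, v₁ - v₂⟩|`. So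
`⟨r₁ - r₂, v₁ - v₂⟩ = 0` almost surely (`ae_inner_sub_sub_eq_zero`), and averaging over `r₂` and `v₂`
shows that `r` is orthogonal to the spanning vectors of `D`. As `r` also takes values in `D`, it
vanishes, and `ζ`, being the law of `(x, π)`, belongs to `S`.
-/

namespace MeasureField

/-! ### Representation of joint laws by a uniform variable -/

/-- Every joint law is that of `(a, g (a, u))`, with `u` uniform on `[0, 1]` and independent of `a`:
disintegrate, then represent the conditional kernel by a function of `u`. -/
theorem exists_map_prod_unitInterval_eq {A B : Type*} [MeasurableSpace A] [MeasurableSpace B]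
    [StandardBorelSpace B] [Nonempty B] (ρ : Measure (A × B)) [IsProbabilityMeasure ρ] :
    ∃ g : A × unitInterval → B, Measurable g ∧
      (ρ.fst.prod (volume : Measure unitInterval)).map (fun q => (q.1, g q)) = ρ := by
  obtain ⟨f, hf, hfκ⟩ :=
    ProbabilityTheory.Kernel.exists_measurable_map_eq_unitInterval ρ.condKernel
  refine ⟨Function.uncurry f, hf, ?_⟩
  ext s hs
  have hm : Measurable (fun q : A × unitInterval => (q.1, Function.uncurry f q)) :=
    measurable_fst.prodMk hf
  conv_rhs => rw [← ρ.disintegrate ρ.condKernel]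
  rw [Measure.compProd_apply hs, Measure.map_apply hm hs, Measure.prod_apply (hm hs)]
  refine lintegral_congr fun a => ?_
  have hfa : Measurable (f a) := hf.comp measurable_prodMk_left
  rw [← hfκ a, Measure.map_apply hfa (measurable_prodMk_left hs)]
  rfl

/-! ### Measurability of the span of a countable measurable family -/

section Span

variable {X E ι : Type*} [NormedAddCommGroup E] [NormedSpace ℝ E]

/-- The linear combination of the vectors `f i x` with the rational coefficients `c`. For countable
`ι` there are countably many of them, and they are dense in the span of the `f i x`. -/
noncomputable def ratComb (f : ι → X → E) (c : ι →₀ ℚ) (x : X) : E :=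
  c.sum fun i q => (q : ℝ) • f i x

theorem ratComb_mem_span (f : ι → X → E) (c : ι →₀ ℚ) (x : X) :
    ratComb f c x ∈ Submodule.span ℝ (Set.range fun i => f i x) :=
  Submodule.sum_mem _ fun i _ =>
    Submodule.smul_mem _ _ (Submodule.subset_span (Set.mem_range_self i))

theorem mem_closure_range_ratComb (f : ι → X → E) (x : X) {y : E}
    (hy : y ∈ Submodule.span ℝ (Set.range fun i => f i x)) :
    y ∈ closure (Set.range fun c => ratComb f c x) := by
  induction hy using Submodule.span_induction with
  | mem z hz =>
    obtain ⟨i, rfl⟩ := hz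
    exact subset_closure ⟨Finsupp.single i 1, by simp [ratComb]⟩
  | zero => exact subset_closure ⟨0, by simp [ratComb]⟩
  | add a b _ _ ha hb =>
    refine map_mem_closure₂ continuous_add ha hb ?_
    rintro _ ⟨c, rfl⟩ _ ⟨c', rfl⟩
    refine ⟨c + c', ?_⟩
    classical
    exact Finsupp.sum_add_index' (by simp) (by intros; push_cast; rw [add_smul])
  | smul r a _ ha =>
    refine map_mem_closure₂ continuous_smul (Rat.denseRange_cast r) ha ?_
    rintro _ ⟨q, rfl⟩ _ ⟨c, rfl⟩
    refine ⟨q • c, ?_⟩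
    simp only [ratComb]
    rw [Finsupp.sum_smul_index' (by simp), Finsupp.smul_sum]
    simp [mul_smul]

variable [MeasurableSpace X] [MeasurableSpace E] [BorelSpace E] [SecondCountableTopology E]

theorem measurable_ratComb {f : ι → X → E} (hf : ∀ i, Measurable (f i)) (c : ι →₀ ℚ) :
    Measurable (ratComb f c) :=
  Finset.measurable_sum _ fun i _ => (hf i).const_smul _

theorem measurableSet_span_inter_nonempty [Countable ι] {f : ι → X → E}
    (hf : ∀ i, Measurable (f i)) {O : Set E} (hO : IsOpen O) :
    MeasurableSet
      {x | ((Submodule.span ℝ (Set.range fun i => f i x) : Set E) ∩ O).Nonempty} := by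
  have : {x | ((Submodule.span ℝ (Set.range fun i => f i x) : Set E) ∩ O).Nonempty} =
      ⋃ c : ι →₀ ℚ, ratComb f c ⁻¹' O := by
    ext x
    simp only [Set.mem_iUnion, Set.mem_preimage]
    constructor
    · rintro ⟨y, hy, hyO⟩
      obtain ⟨_, hz, c, rfl⟩ :=
        mem_closure_iff.1 (mem_closure_range_ratComb f x hy) O hO hyO
      exact ⟨c, hz⟩
    · rintro ⟨c, hc⟩
      exact ⟨_, ratComb_mem_span f c x, hc⟩
  rw [this]
  exact MeasurableSet.iUnion fun c => measurable_ratComb hf c hO.measurableSet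

theorem measurableSet_mem_span [FiniteDimensional ℝ E] [Countable ι] {f : ι → X → E}
    (hf : ∀ i, Measurable (f i)) :
    MeasurableSet {p : X × E | p.2 ∈ Submodule.span ℝ (Set.range fun i => f i p.1)} := by
  have : {p : X × E | p.2 ∈ Submodule.span ℝ (Set.range fun i => f i p.1)} =
      ⋂ n : ℕ, ⋃ c : ι →₀ ℚ, {p | dist p.2 (ratComb f c p.1) < 1 / ((n : ℝ) + 1)} := by
    ext p
    simp only [Set.mem_iInter, Set.mem_iUnion]
    refine Iff.trans ?_ Metric.mem_closure_range_iff_nat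
    refine ⟨mem_closure_range_ratComb f p.1, fun h => ?_⟩
    have hcl := (Submodule.span ℝ (Set.range fun i => f i p.1)).closed_of_finiteDimensional
    refine closure_minimal ?_ hcl h
    rintro _ ⟨c, rfl⟩
    exact ratComb_mem_span f c p.1
  rw [this]
  refine MeasurableSet.iInter fun n => MeasurableSet.iUnion fun c => ?_
  exact measurableSet_lt
    (measurable_snd.dist ((measurable_ratComb hf c).comp measurable_fst)) measurable_const

end Span

/-! ### Square-integrable random vectors and their covariance -/

/-- A square-integrable vector `g` almost surely lies in the range of its second moment matrix
`∫ g gᵀ`: if `y` is orthogonal to the columns, then `∫ ⟨y, g⟩² = 0`. -/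
theorem ae_mem_span_integral_coord_smul {d : ℕ} {U : Type*} [MeasurableSpace U] {ν : Measure U}
    {g : U → Pt d} (hg : MemLp g 2 ν) :
    ∀ᵐ u ∂ν, g u ∈ Submodule.span ℝ (Set.range fun i : Fin d => ∫ u, g u i • g u ∂ν) := by
  set K := Submodule.span ℝ (Set.range fun i : Fin d => ∫ u, g u i • g u ∂ν) with hK
  have hgi : ∀ i, MemLp (fun u => g u i) 2 ν := fun i =>
    (EuclideanSpace.proj (𝕜 := ℝ) i).comp_memLp' hg
  have hint : ∀ i, Integrable (fun u => g u i • g u) ν := fun i =>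
    memLp_one_iff_integrable.1 (hg.smul (hgi i))
  have key : ∀ y ∈ Kᗮ, ∀ᵐ u ∂ν, inner ℝ y (g u) = 0 := by
    intro y hy
    have hy0 : ∀ i, ∫ u, g u i * inner ℝ y (g u) ∂ν = 0 := by
      intro i
      have := integral_inner (𝕜 := ℝ) (hint i) y
      simp only [inner_smul_right] at this
      rw [this, real_inner_comm]
      exact hy _ (Submodule.subset_span (Set.mem_range_self i))
    have hyL : MemLp (fun u => inner ℝ y (g u)) 2 ν := (innerSL ℝ y).comp_memLp' hg
    have hsq : ∫ u, (inner ℝ y (g u)) ^ 2 ∂ν = 0 := by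
      have : ∀ u, (inner ℝ y (g u)) ^ 2 = ∑ i, y i * (g u i * inner ℝ y (g u)) := by
        intro u
        have hexp : inner ℝ y (g u) = ∑ i, y i * g u i := by
          simp [PiLp.inner_apply, mul_comm]
        simp_rw [← mul_assoc, ← Finset.sum_mul]
        rw [← hexp, sq]
      simp_rw [this]
      rw [integral_finsetSum]
      · simp [integral_const_mul, hy0]
      · intro i _
        exact ((hgi i).integrable_mul hyL).const_mul _
    rw [integral_eq_zero_iff_of_nonneg (fun _ => sq_nonneg _) hyL.integrable_sq] at hsq
    filter_upwards [hsq] with u hu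
    simpa using hu
  -- Finitely many `y` suffice: a basis of `Kᗮ`.
  have hb := ae_all_iff.2 fun j => key _ ((stdOrthonormalBasis ℝ Kᗮ) j).2
  filter_upwards [hb] with u hu
  rw [← K.orthogonal_orthogonal, Submodule.mem_orthogonal]
  intro y hy
  have := (stdOrthonormalBasis ℝ Kᗮ).sum_repr ⟨y, hy⟩
  have h2 := congrArg Subtype.val this
  simp only [Submodule.coe_sum, Submodule.coe_smul] at h2
  rw [← h2, sum_inner]
  refine Finset.sum_eq_zero fun j _ => ?_
  rw [inner_smul_left, hu j, mul_zero]

theorem integrable_inner_of_memLp {d : ℕ} {U : Type*} [MeasurableSpace U] {ν : Measure U}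
    {f g : U → Pt d} (hf : MemLp f 2 ν) (hg : MemLp g 2 ν) :
    Integrable (fun u => inner ℝ (f u) (g u)) ν := by
  refine (hf.norm.integrable_mul hg.norm).mono' (hf.1.inner hg.1) ?_
  exact Eventually.of_forall fun u => norm_inner_le_norm _ _

theorem integral_inner_sub_of_integral_eq_zero {E U : Type*} [NormedAddCommGroup E]
    [InnerProductSpace ℝ E] [CompleteSpace E] [MeasurableSpace U] {ν : Measure U}
    [IsProbabilityMeasure ν] {g : U → E} (hg : Integrable g ν) (hg0 : ∫ u, g u ∂ν = 0) (y a : E) :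
    ∫ u, inner ℝ y (a - g u) ∂ν = inner ℝ y a := by
  rw [integral_inner (f := fun u => a - g u) ((integrable_const _).sub hg),
    integral_sub (integrable_const _) hg, hg0]
  simp

/-- Averaging the relation `⟨f a - f b, g c - g e⟩ = 0` first over `e`, then, after multiplying by
`g c`, over `c`, and finally over `b` leaves `f a` orthogonal to the second moment matrix of `g`. -/
theorem ae_inner_integral_eq_zero {d : ℕ} {U : Type*} [MeasurableSpace U] {ν : Measure U}
    [IsProbabilityMeasure ν] {f g : U → Pt d} (hf : Integrable f ν) (hg : MemLp g 2 ν)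
    (hf0 : ∫ u, f u ∂ν = 0) (hg0 : ∫ u, g u ∂ν = 0)
    (h : ∀ᵐ q ∂((ν.prod ν).prod (ν.prod ν)),
      inner ℝ (f q.1.1 - f q.1.2) (g q.2.1 - g q.2.2) = 0) (i : Fin d) :
    ∀ᵐ a ∂ν, inner ℝ (f a) (∫ u, g u i • g u ∂ν) = 0 := by
  have hgI : Integrable g ν := hg.integrable (by norm_num)
  have hgi : MemLp (fun u => g u i) 2 ν := (EuclideanSpace.proj (𝕜 := ℝ) i).comp_memLp' hg
  have hint : Integrable (fun u => g u i • g u) ν := memLp_one_iff_integrable.1 (hg.smul hgi)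
  have hab := Measure.ae_ae_of_ae_prod (Measure.ae_ae_of_ae_prod h)
  filter_upwards [hab] with a ha
  have hb : ∀ᵐ b ∂ν, inner ℝ (f a - f b) (∫ u, g u i • g u ∂ν) = 0 := by
    filter_upwards [ha] with b hb
    have hc : ∀ᵐ c ∂ν, inner ℝ (f a - f b) (g c) = 0 := by
      filter_upwards [Measure.ae_ae_of_ae_prod hb] with c hc
      have h1 : ∫ e, inner ℝ (f a - f b) (g c - g e) ∂ν = 0 :=
        integral_eq_zero_of_ae hc
      rwa [integral_inner_sub_of_integral_eq_zero hgI hg0] at h1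
    rw [← integral_inner hint]
    refine integral_eq_zero_of_ae ?_
    filter_upwards [hc] with c hc
    rw [inner_smul_right, hc, mul_zero]; rfl
  have h1 : ∫ b, inner ℝ (∫ u, g u i • g u ∂ν) (f a - f b) ∂ν = 0 := by
    refine integral_eq_zero_of_ae ?_
    filter_upwards [hb] with b hb
    rw [real_inner_comm, hb]; rfl
  rwa [integral_inner_sub_of_integral_eq_zero hf hf0, real_inner_comm] at h1

/-! ### Operations on fields given as laws of random vectors -/

section RandomVectors

variable {d : ℕ} {Ω : Type*} [MeasurableSpace Ω] {P : Measure Ω}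

theorem memLp_two_iff_lintegral {E : Type*} [NormedAddCommGroup E] {v : Ω → E}
    (hv : AEStronglyMeasurable v P) : MemLp v 2 P ↔ ∫⁻ o, ‖v o‖ₑ ^ 2 ∂P < ∞ := by
  rw [MemLp, and_iff_right hv,
    eLpNorm_lt_top_iff_lintegral_rpow_enorm_lt_top (by norm_num) (by norm_num)]
  simp

theorem map_mem_fields_iff {μ : Measure (Pt d)} {X v : Ω → Pt d} (hX : Measurable X)
    (hv : Measurable v) :
    P.map (fun o => (X o, v o)) ∈ fields μ ↔
      IsProbabilityMeasure P ∧ MemLp X 2 P ∧ MemLp v 2 P ∧ P.map X = μ := by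
  have hXv : Measurable fun o => (X o, v o) := hX.prodMk hv
  rw [fields, Set.mem_ofPred_eq, Measure.map_map measurable_fst hXv,
    lintegral_map (by fun_prop) hXv, memLp_two_iff_lintegral hX.aestronglyMeasurable,
    memLp_two_iff_lintegral hv.aestronglyMeasurable,
    lintegral_add_left (by fun_prop), ENNReal.add_lt_top, and_assoc]
  refine and_congr ⟨fun h => ⟨?_⟩, fun h => Measure.isProbabilityMeasure_map hXv.aemeasurable⟩
    Iff.rfl
  simpa [Measure.map_apply hXv MeasurableSet.univ] using h.measure_univ

theorem map_mem_plans [IsProbabilityMeasure P] {X v w : Ω → Pt d} (hX : Measurable X)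
    (hv : Measurable v) (hw : Measurable w) (hX2 : MemLp X 2 P) (hv2 : MemLp v 2 P)
    (hw2 : MemLp w 2 P) :
    P.map (fun o => (X o, v o, w o)) ∈
      plans (P.map fun o => (X o, v o)) (P.map fun o => (X o, w o)) := by
  have hm : Measurable fun o => (X o, v o, w o) := hX.prodMk (hv.prodMk hw)
  refine ⟨Measure.isProbabilityMeasure_map hm.aemeasurable, ?_, ?_, ?_⟩
  · rw [memLp_two_iff_lintegral (Measurable.aestronglyMeasurable ‹_›)] at hX2 hv2 hw2
    rw [lintegral_map (by fun_prop) hm, lintegral_add_left (by fun_prop),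
      lintegral_add_left (by fun_prop)]
    exact ENNReal.add_lt_top.2 ⟨ENNReal.add_lt_top.2 ⟨hX2, hv2⟩, hw2⟩
  · rw [Measure.map_map (by fun_prop) hm]; rfl
  · rw [Measure.map_map (by fun_prop) hm]; rfl

section Cone

variable {μ : Measure (Pt d)} {S : Set (Measure (TBundle d))}

/-- Horizontal convexity for random vectors: the joint law of `(X, v, w)` is an admissible plan. -/
theorem map_combo_mem (hS : S ⊆ fields μ) (hconvex : IsHorizontallyConvex S)
    {X v w : Ω → Pt d} (hX : Measurable X) (hv : Measurable v) (hw : Measurable w)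
    (hvS : P.map (fun o => (X o, v o)) ∈ S) (hwS : P.map (fun o => (X o, w o)) ∈ S)
    {r : ℝ} (hr0 : 0 ≤ r) (hr1 : r ≤ 1) :
    P.map (fun o => (X o, (1 - r) • v o + r • w o)) ∈ S := by
  obtain ⟨hP, hX2, hv2, -⟩ := (map_mem_fields_iff hX hv).1 (hS hvS)
  obtain ⟨-, -, hw2, -⟩ := (map_mem_fields_iff hX hw).1 (hS hwS)
  have := hconvex r hr0 hr1 _ hvS _ hwS _ (map_mem_plans hX hv hw hX2 hv2 hw2)
  rwa [Measure.map_map (by fun_prop) (hX.prodMk (hv.prodMk hw))] at this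

theorem map_smul_mem (hcone : IsCone S) {X v : Ω → Pt d} (hX : Measurable X)
    (hv : Measurable v) (hvS : P.map (fun o => (X o, v o)) ∈ S) {r : ℝ} (hr : 0 ≤ r) :
    P.map (fun o => (X o, r • v o)) ∈ S := by
  have := hcone _ hvS r hr
  rwa [scale, Measure.map_map (by fun_prop) (hX.prodMk hv)] at this

theorem map_add_mem (hS : S ⊆ fields μ) (hconvex : IsHorizontallyConvex S) (hcone : IsCone S)
    {X v w : Ω → Pt d} (hX : Measurable X) (hv : Measurable v) (hw : Measurable w)
    (hvS : P.map (fun o => (X o, v o)) ∈ S) (hwS : P.map (fun o => (X o, w o)) ∈ S) :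
    P.map (fun o => (X o, v o + w o)) ∈ S := by
  have h := map_combo_mem hS hconvex hX (hv.const_smul (2 : ℝ)) (hw.const_smul (2 : ℝ))
    (map_smul_mem hcone hX hv hvS zero_le_two) (map_smul_mem hcone hX hw hwS zero_le_two)
    (r := 1 / 2) (by norm_num) (by norm_num)
  have heq : ∀ o, (1 - 1 / 2 : ℝ) • (2 : ℝ) • v o + (1 / 2 : ℝ) • (2 : ℝ) • w o = v o + w o := by
    intro o
    module
  simpa only [Pi.smul_apply, heq] using h

theorem W_map_le_eLpNorm [IsProbabilityMeasure P] {X v w : Ω → Pt d} (hX : Measurable X)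
    (hv : Measurable v) (hw : Measurable w) (hX2 : MemLp X 2 P) (hv2 : MemLp v 2 P)
    (hw2 : MemLp w 2 P) :
    W (P.map fun o => (X o, v o)) (P.map fun o => (X o, w o)) ≤ eLpNorm (v - w) 2 P := by
  rw [eLpNorm_eq_lintegral_rpow_enorm_toReal (by norm_num) (by norm_num), W]
  simp only [ENNReal.toReal_ofNat]
  gcongr
  refine (iInf₂_le _ (map_mem_plans hX hv hw hX2 hv2 hw2)).trans_eq ?_
  rw [lintegral_map (by fun_prop) (hX.prodMk (hv.prodMk hw))]
  simp

theorem map_mem_of_tendsto (hS : S ⊆ fields μ) (hclosed : IsWClosed μ S) {X v : Ω → Pt d}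
    {V : ℕ → Ω → Pt d} (hX : Measurable X) (hv : Measurable v) (hV : ∀ n, Measurable (V n))
    (hv2 : MemLp v 2 P) (hVS : ∀ n, P.map (fun o => (X o, V n o)) ∈ S)
    (hlim : Tendsto (fun n => eLpNorm (V n - v) 2 P) atTop (𝓝 0)) :
    P.map (fun o => (X o, v o)) ∈ S := by
  have hf := fun n => (map_mem_fields_iff hX (hV n)).1 (hS (hVS n))
  obtain ⟨hP, hX2, -, hXμ⟩ := hf 0
  refine hclosed _ _ hVS ((map_mem_fields_iff hX hv).2 ⟨hP, hX2, hv2, hXμ⟩) ?_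
  exact tendsto_of_tendsto_of_tendsto_of_le_of_le tendsto_const_nhds hlim (fun _ => zero_le)
    fun n => W_map_le_eLpNorm hX (hV n) hv hX2 (hf n).2.2.1 hv2

end Cone

end RandomVectors

/-! ### Centred fields and optimal plans -/

section OptimalPlans

variable {d : ℕ} {μ : Measure (Pt d)} {S : Set (Measure (TBundle d))}

theorem isProbabilityMeasure_of_mem_fields {ξ : Measure (TBundle d)} (hξ : ξ ∈ fields μ) :
    IsProbabilityMeasure μ := by
  have := hξ.1
  rw [← hξ.2.2]
  exact Measure.isProbabilityMeasure_map measurable_fst.aemeasurable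

/-- A centred field has mean zero in almost every fibre: test the barycenter against
`φ (x, v) = g x * ⟨z, v⟩` with `g` smooth and compactly supported. -/
theorem ae_integral_eq_zero_of_map_mem_centredFields {U : Type*} [MeasurableSpace U]
    {ν : Measure U} [IsProbabilityMeasure ν] {v : Pt d × U → Pt d} (hv : Measurable v)
    (h : (μ.prod ν).map (fun q => (q.1, v q)) ∈ centredFields μ) :
    ∀ᵐ x ∂μ, ∫ u, v (x, u) ∂ν = 0 := by
  have := isProbabilityMeasure_of_mem_fields h.1
  obtain ⟨-, -, hv2, -⟩ := (map_mem_fields_iff measurable_fst hv).1 h.1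
  have hvI : Integrable v (μ.prod ν) := hv2.integrable (by norm_num)
  have hm : Integrable (fun x => ∫ u, v (x, u) ∂ν) μ := hvI.integral_prod_left
  refine ae_eq_zero_of_integral_contDiff_smul_eq_zero hm.locallyIntegrable fun g hg hgs => ?_
  -- The test vector is the integral itself, which is then orthogonal to itself.
  obtain ⟨C, hC⟩ := hgs.exists_bound_of_continuous hg.continuous
  set z := ∫ x, g x • ∫ u, v (x, u) ∂ν ∂μ with hz
  have hgm : Integrable (fun x => g x • ∫ u, v (x, u) ∂ν) μ :=
    hm.bdd_smul C hg.continuous.aestronglyMeasurable (Eventually.of_forall hC)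
  have hgv : Integrable (fun q : Pt d × U => g q.1 • v q) (μ.prod ν) :=
    hvI.bdd_smul C (hg.continuous.measurable.comp measurable_fst).aestronglyMeasurable
      (Eventually.of_forall fun q => hC q.1)
  have hφc : Continuous fun p : TBundle d => g p.1 * inner ℝ z p.2 := by
    have := hg.continuous
    fun_prop
  have hφ := h.2.2 (fun p => g p.1 * inner ℝ z p.2) hφc
    ⟨C * ‖z‖, fun p => ?_⟩ fun x => ⟨fun a b => by simp [inner_add_right, mul_add],
      fun c a => by simp [inner_smul_right]; ring⟩
  · rw [integral_map (measurable_fst.prodMk hv).aemeasurable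
      hφc.aestronglyMeasurable] at hφ
    simp only [inner_zero_right, mul_zero, integral_zero] at hφ
    have h1 : ∫ q, inner ℝ z (g q.1 • v q) ∂(μ.prod ν) = 0 := by
      simpa only [inner_smul_right] using hφ
    rw [integral_inner hgv, integral_prod _ hgv] at h1
    simp only [integral_smul] at h1
    exact inner_self_eq_zero.1 h1
  · rw [abs_mul, mul_assoc]
    refine mul_le_mul (hC p.1) ?_ (abs_nonneg _) ((norm_nonneg _).trans (hC p.1))
    refine (abs_real_inner_le_norm _ _).trans ?_
    gcongr
    nlinarith [sq_nonneg ‖p.1‖, sq_nonneg (‖p.2‖ - 1), norm_nonneg p.2]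

theorem exists_map_prod_unitInterval_eq_of_mem_fields {ξ : Measure (TBundle d)}
    (hξ : ξ ∈ fields μ) : ∃ v : Pt d × unitInterval → Pt d, Measurable v ∧
      (μ.prod (volume : Measure unitInterval)).map (fun q => (q.1, v q)) = ξ := by
  have := hξ.1
  obtain ⟨v, hv, h⟩ := exists_map_prod_unitInterval_eq ξ
  exact ⟨v, hv, by rwa [Measure.fst, hξ.2.2] at h⟩

/-- Among all plans between `ζ` and elements of `S`, on whatever probability space they are
realized, one has minimal cost. On `ζ ⊗ du` the projection theorem applies to the closed convex set
of vectors with law in `S`, and this space is rich enough: every plan is the joint law of the point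
`p` of law `ζ` and some `g (p, u)`. -/
theorem exists_optimal_plan (hS : S ⊆ fields μ) (hne : S.Nonempty) (hclosed : IsWClosed μ S)
    (hconvex : IsHorizontallyConvex S) {ζ : Measure (TBundle d)} (hζ : ζ ∈ fields μ) :
    ∃ π : TBundle d × unitInterval → Pt d, Measurable π ∧
      (ζ.prod (volume : Measure unitInterval)).map (fun q => (q.1.1, π q)) ∈ S ∧
      ∀ {Ω : Type} [MeasurableSpace Ω] (P : Measure Ω) (X w v : Ω → Pt d),
        Measurable X → Measurable w → Measurable v →
        P.map (fun o => (X o, w o)) = ζ → P.map (fun o => (X o, v o)) ∈ S →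
        ∫ q, ‖q.1.2 - π q‖ ^ 2 ∂(ζ.prod (volume : Measure unitInterval)) ≤
          ∫ o, ‖w o - v o‖ ^ 2 ∂P := by
  have := hζ.1
  set Q : Measure (TBundle d × unitInterval) := ζ.prod volume with hQ
  let X₀ : TBundle d × unitInterval → Pt d := fun q => q.1.1
  let w₀ : TBundle d × unitInterval → Pt d := fun q => q.1.2
  have hX₀ : Measurable X₀ := by fun_prop
  have hw₀ : Measurable w₀ := by fun_prop
  have hw₀ζ : Q.map (fun q => (X₀ q, w₀ q)) = ζ :=
    (measurePreserving_fst (μ := ζ) (ν := (volume : Measure unitInterval))).map_eq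
  have hw₀2 : MemLp w₀ 2 Q :=
    ((map_mem_fields_iff hX₀ hw₀).1 (hw₀ζ.symm ▸ hζ)).2.2.1
  let K : Set (Lp (Pt d) 2 Q) := {f | Q.map (fun q => (X₀ q, f q)) ∈ S}
  have hcongr : ∀ {f g : TBundle d × unitInterval → Pt d}, f =ᵐ[Q] g →
      Q.map (fun q => (X₀ q, f q)) = Q.map (fun q => (X₀ q, g q)) := by
    intro f g hfg
    refine Measure.map_congr ?_
    filter_upwards [hfg] with q hq
    rw [hq]
  have hKmem : ∀ {g : TBundle d × unitInterval → Pt d}, Measurable g →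
      Q.map (fun q => (X₀ q, g q)) ∈ S → ∃ hg : MemLp g 2 Q, hg.toLp g ∈ K := by
    intro g hg hgS
    have hg2 := ((map_mem_fields_iff hX₀ hg).1 (hS hgS)).2.2.1
    refine ⟨hg2, ?_⟩
    change Q.map (fun q => (X₀ q, hg2.toLp g q)) ∈ S
    rwa [hcongr hg2.coeFn_toLp]
  have hmeas : ∀ f : Lp (Pt d) 2 Q, Measurable f := fun f => (Lp.stronglyMeasurable f).measurable
  have hKne : K.Nonempty := by
    obtain ⟨ξ, hξ⟩ := hne
    obtain ⟨g, hg, hgξ⟩ := exists_map_prod_unitInterval_eq_of_mem_fields (hS hξ)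
    have hmp : MeasurePreserving
        (Prod.map Prod.fst id : TBundle d × unitInterval → Pt d × unitInterval) Q
        (μ.prod volume) :=
      MeasurePreserving.prod ⟨measurable_fst, hζ.2.2⟩ (MeasurePreserving.id _)
    have hgS : Q.map (fun q => (X₀ q, g (q.1.1, q.2))) ∈ S := by
      rw [← hgξ, ← hmp.map_eq, Measure.map_map (measurable_fst.prodMk hg) hmp.measurable] at hξ
      exact hξ
    obtain ⟨_, hK⟩ := hKmem (hg.comp hmp.measurable) hgS
    exact ⟨_, hK⟩
  have hKcl : IsClosed K := by
    refine IsSeqClosed.isClosed fun f g hf hfg => ?_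
    exact map_mem_of_tendsto hS hclosed hX₀ (hmeas g) (fun n => hmeas (f n)) (Lp.memLp g) hf
      ((Lp.tendsto_Lp_iff_tendsto_eLpNorm' f g).1 hfg)
  have hKco : Convex ℝ K := by
    intro f hf g hg a b ha hb hab
    obtain rfl : a = 1 - b := by linarith
    have := map_combo_mem hS hconvex hX₀ (hmeas f) (hmeas g) hf hg hb (by linarith)
    change Q.map _ ∈ S
    rwa [hcongr (g := fun q => (1 - b) • f q + b • g q)]
    filter_upwards [Lp.coeFn_add ((1 - b) • f) (b • g), Lp.coeFn_smul (1 - b) f,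
      Lp.coeFn_smul b g] with q h1 h2 h3
    rw [h1, Pi.add_apply, h2, h3]; rfl
  obtain ⟨f, hfK, hf⟩ :=
    exists_norm_eq_iInf_of_complete_convex hKne hKcl.isComplete hKco (hw₀2.toLp w₀)
  have hnorm : ∀ {g : TBundle d × unitInterval → Pt d} (h : Lp (Pt d) 2 Q), h =ᵐ[Q] g →
      ‖hw₀2.toLp w₀ - h‖ ^ 2 = ∫ q, ‖w₀ q - g q‖ ^ 2 ∂Q := by
    intro g h hh
    rw [← real_inner_self_eq_norm_sq, L2.inner_def]
    refine integral_congr_ae ?_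
    filter_upwards [Lp.coeFn_sub (hw₀2.toLp w₀) h, hw₀2.coeFn_toLp, hh] with q h1 h2 h3
    rw [real_inner_self_eq_norm_sq, h1, Pi.sub_apply, h2, h3]
  refine ⟨f, hmeas f, hfK, ?_⟩
  intro Ω _ P X w v hX hw hv hwζ hvS
  have hP := ((map_mem_fields_iff hX hv).1 (hS hvS)).1
  have hXwv : Measurable fun o => ((X o, w o), v o) := (hX.prodMk hw).prodMk hv
  have := Measure.isProbabilityMeasure_map (μ := P) hXwv.aemeasurable
  obtain ⟨g, hg, hgρ⟩ := exists_map_prod_unitInterval_eq (P.map fun o => ((X o, w o), v o))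
  rw [Measure.fst, Measure.map_map measurable_fst hXwv] at hgρ
  change Measure.map _ ((P.map fun o => (X o, w o)).prod volume) = _ at hgρ
  rw [hwζ] at hgρ
  have hmg : Measurable fun q : TBundle d × unitInterval => (q.1, g q) := measurable_fst.prodMk hg
  have hgS : Q.map (fun q => (X₀ q, g q)) ∈ S := by
    have h1 := congrArg (Measure.map fun t : TBundle d × Pt d => (t.1.1, t.2)) hgρ
    rw [Measure.map_map (by fun_prop) hmg, Measure.map_map (by fun_prop) hXwv] at h1
    exact h1 ▸ hvS
  obtain ⟨hg2, hgK⟩ := hKmem hg hgS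
  have hle : ‖hw₀2.toLp w₀ - f‖ ≤ ‖hw₀2.toLp w₀ - hg2.toLp g‖ := by
    rw [hf]
    exact ciInf_le ⟨0, Set.forall_mem_range.2 fun _ => norm_nonneg _⟩ (⟨_, hgK⟩ : K)
  have hle2 := pow_le_pow_left₀ (norm_nonneg _) hle 2
  rw [hnorm f (ae_eq_refl _), hnorm (g := g) _ hg2.coeFn_toLp] at hle2
  refine hle2.trans_eq ?_
  have hc : Continuous fun t : TBundle d × Pt d => ‖t.1.2 - t.2‖ ^ 2 := by fun_prop
  have h1 := congrArg (fun m => ∫ t, ‖t.1.2 - t.2‖ ^ 2 ∂m) hgρ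
  rwa [integral_map hmg.aemeasurable hc.aestronglyMeasurable,
    integral_map hXwv.aemeasurable hc.aestronglyMeasurable] at h1

end OptimalPlans

/-! ### The optimal residual is orthogonal to independent copies of the fields in the cone -/

section Residual

variable {d : ℕ} {μ : Measure (Pt d)} {S : Set (Measure (TBundle d))}

theorem integral_inner_nonpos_of_forall_le {Ω : Type*} [MeasurableSpace Ω] {P : Measure Ω}
    {r V : Ω → Pt d} (hr : MemLp r 2 P) (hV : MemLp V 2 P)
    (h : ∀ t : ℝ, 0 ≤ t → ∫ o, ‖r o‖ ^ 2 ∂P ≤ ∫ o, ‖r o - t • V o‖ ^ 2 ∂P) :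
    ∫ o, inner ℝ (r o) (V o) ∂P ≤ 0 := by
  have hrV := integrable_inner_of_memLp hr hV
  have hr2 : Integrable (fun o => ‖r o‖ ^ 2) P := hr.integrable_norm_pow two_ne_zero
  have hV2 : Integrable (fun o => ‖V o‖ ^ 2) P := hV.integrable_norm_pow two_ne_zero
  have hexp : ∀ t : ℝ, ∫ o, ‖r o - t • V o‖ ^ 2 ∂P =
      ∫ o, ‖r o‖ ^ 2 ∂P - 2 * t * ∫ o, inner ℝ (r o) (V o) ∂P
        + t ^ 2 * ∫ o, ‖V o‖ ^ 2 ∂P := by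
    intro t
    have hsub : Integrable (fun o => ‖r o‖ ^ 2 - 2 * t * inner ℝ (r o) (V o)) P :=
      hr2.sub (hrV.const_mul _)
    rw [← integral_const_mul, ← integral_const_mul, ← integral_sub hr2 (hrV.const_mul _),
      ← integral_add hsub (hV2.const_mul _)]
    refine integral_congr_ae (Eventually.of_forall fun o => ?_)
    simp only
    rw [norm_sub_sq_real, inner_smul_right, norm_smul, mul_pow, Real.norm_eq_abs, sq_abs]
    ring
  by_contra! hpos
  set I := ∫ o, inner ℝ (r o) (V o) ∂P
  set N := ∫ o, ‖V o‖ ^ 2 ∂P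
  have hN : 0 ≤ N := integral_nonneg fun _ => by positivity
  -- The parabola `t ↦ -2 t I + t² N` is negative at `t = I / (N + 1)`.
  have ht : 0 < I / (N + 1) := by positivity
  have h1 := h (I / (N + 1)) ht.le
  rw [hexp] at h1
  have h2 : I / (N + 1) * (N + 1) = I := by field_simp
  nlinarith [mul_pos ht ht]

/-- If a measure-preserving `T` maps `f` to `g` and leaves the event `A` invariant, then following
`f` on `A` and `g` off `A` does not change the law, since `g` on `Aᶜ` has the same law there as `f`. -/
theorem map_ite_eq_of_swap {Ω E : Type*} [MeasurableSpace Ω] [MeasurableSpace E] {P : Measure Ω}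
    [IsFiniteMeasure P] {T : Ω → Ω} (hT : MeasurePreserving T P P) {A : Set Ω}
    (hA : MeasurableSet A) (hTA : T ⁻¹' A = A) {f g : Ω → E} (hf : Measurable f)
    (hg : Measurable g) (hfT : f ∘ T = g) [DecidablePred (· ∈ A)] :
    P.map (fun o => if o ∈ A then f o else g o) = P.map f := by
  have hfg : P.map g = P.map f := by
    rw [← hfT, ← Measure.map_map hf hT.measurable, hT.map_eq]
  have hV : Measurable fun o => if o ∈ A then f o else g o := Measurable.ite hA hf hg
  ext s hs
  rw [Measure.map_apply hV hs, Measure.map_apply hf hs,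
    ← measure_inter_add_sdiff _ hA, ← measure_inter_add_sdiff (f ⁻¹' s) hA]
  congr 1
  · congr 1
    ext o
    by_cases ho : o ∈ A <;> simp [ho]
  · rw [← hT.measure_preimage
      (((hf hs).diff hA).nullMeasurableSet)]
    congr 1
    rw [Set.preimage_sdiff, hTA, ← Set.preimage_comp, hfT]
    ext o
    by_cases ho : o ∈ A <;> simp [ho]

section IndependentCopies

variable {U : Type*} [MeasurableSpace U] {ν : Measure U} [IsProbabilityMeasure ν]
  [IsProbabilityMeasure μ]

/-- Fibrewise independent vectors, one of which has mean zero in almost every fibre, are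
orthogonal in `L²`. Here `q` and `q'` select the variables they depend on. -/
theorem integral_inner_indep_eq_zero {r v : Pt d × U → Pt d} (hr : MemLp r 2 (μ.prod ν))
    (hr0 : ∀ᵐ x ∂μ, ∫ u, r (x, u) ∂ν = 0)
    {q : U × U → U} {q' : U × U → U} (hq : MeasurePreserving q (ν.prod ν) ν)
    (hint : Integrable (fun o : Pt d × ((U × U) × (U × U)) =>
      inner ℝ (r (o.1, q o.2.1)) (v (o.1, q' o.2.2))) (μ.prod ((ν.prod ν).prod (ν.prod ν)))) :
    ∫ o, inner ℝ (r (o.1, q o.2.1)) (v (o.1, q' o.2.2))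
      ∂(μ.prod ((ν.prod ν).prod (ν.prod ν))) = 0 := by
  rw [integral_prod _ hint]
  refine integral_eq_zero_of_ae ?_
  have hrI : Integrable r (μ.prod ν) := hr.integrable (by norm_num)
  filter_upwards [hr0, hrI.prod_right_ae, hint.prod_right_ae] with x hx hxI hxint
  rw [integral_prod_symm _ hxint]
  refine integral_eq_zero_of_ae (Eventually.of_forall fun b => ?_)
  simp only [Pi.zero_apply]
  have hc : ∫ a, r (x, q a) ∂(ν.prod ν) = ∫ u, r (x, u) ∂ν := by
    conv_rhs => rw [← hq.map_eq]
    rw [integral_map hq.measurable.aemeasurable (hq.map_eq.symm ▸ hxI.1)]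
  have hi : Integrable (fun a => r (x, q a)) (ν.prod ν) := 
    hq.integrable_comp_of_integrable hxI
  have hcomm : ∀ a, inner ℝ (r (x, q a)) (v (x, q' b)) = inner ℝ (v (x, q' b)) (r (x, q a)) :=
    fun a => real_inner_comm _ _
  simp only [hcomm]
  rw [integral_inner hi, hc, hx, inner_zero_right]

/-- If `r` has nonpositive correlation with every vector `V` for which `(x, V)` has the law of
`(x, v)`, then differences of fibrewise independent copies of `r` and of `v` are almost surely
orthogonal. -/
theorem ae_inner_sub_sub_eq_zero {r v : Pt d × U → Pt d} (hrm : Measurable r)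
    (hvm : Measurable v) (hr : MemLp r 2 (μ.prod ν)) (hv : MemLp v 2 (μ.prod ν))
    (hr0 : ∀ᵐ x ∂μ, ∫ u, r (x, u) ∂ν = 0)
    (hopt : ∀ V : Pt d × ((U × U) × (U × U)) → Pt d, Measurable V →
      (μ.prod ((ν.prod ν).prod (ν.prod ν))).map (fun o => (o.1, V o)) =
        (μ.prod ν).map (fun q => (q.1, v q)) →
      ∫ o, inner ℝ (r (o.1, o.2.1.1)) (V o) ∂(μ.prod ((ν.prod ν).prod (ν.prod ν))) ≤ 0) :
    ∀ᵐ o ∂(μ.prod ((ν.prod ν).prod (ν.prod ν))),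
      inner ℝ (r (o.1, o.2.1.1) - r (o.1, o.2.1.2)) (v (o.1, o.2.2.1) - v (o.1, o.2.2.2)) = 0 := by
  classical
  set P := μ.prod ((ν.prod ν).prod (ν.prod ν)) with hP
  let r₁ : Pt d × ((U × U) × (U × U)) → Pt d := fun o => r (o.1, o.2.1.1)
  let r₂ : Pt d × ((U × U) × (U × U)) → Pt d := fun o => r (o.1, o.2.1.2)
  let v₁ : Pt d × ((U × U) × (U × U)) → Pt d := fun o => v (o.1, o.2.2.1)
  let v₂ : Pt d × ((U × U) × (U × U)) → Pt d := fun o => v (o.1, o.2.2.2)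
  have hproj : ∀ {q : (U × U) × (U × U) → U}, MeasurePreserving q ((ν.prod ν).prod (ν.prod ν)) ν →
      MeasurePreserving (Prod.map id q) P (μ.prod ν) := fun hq => (MeasurePreserving.id μ).prod hq
  have m₁ := hproj ((measurePreserving_fst (μ := ν) (ν := ν)).comp
    (measurePreserving_fst (μ := ν.prod ν) (ν := ν.prod ν)))
  have m₂ := hproj ((measurePreserving_snd (μ := ν) (ν := ν)).comp
    (measurePreserving_fst (μ := ν.prod ν) (ν := ν.prod ν)))
  have m₃ := hproj ((measurePreserving_fst (μ := ν) (ν := ν)).comp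
    (measurePreserving_snd (μ := ν.prod ν) (ν := ν.prod ν)))
  have m₄ := hproj ((measurePreserving_snd (μ := ν) (ν := ν)).comp
    (measurePreserving_snd (μ := ν.prod ν) (ν := ν.prod ν)))
  have hr₁ : MemLp r₁ 2 P := hr.comp_measurePreserving m₁
  have hr₂ : MemLp r₂ 2 P := hr.comp_measurePreserving m₂
  have hv₁ : MemLp v₁ 2 P := hv.comp_measurePreserving m₃
  have hv₂ : MemLp v₂ 2 P := hv.comp_measurePreserving m₄
  have hv₁m : Measurable v₁ := hvm.comp m₃.measurable
  have hv₂m : Measurable v₂ := hvm.comp m₄.measurable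
  have hr₁m : Measurable r₁ := hrm.comp m₁.measurable
  have hr₂m : Measurable r₂ := hrm.comp m₂.measurable
  -- `T` exchanges the two copies of `r` and, at the same time, those of `v`.
  let T : Pt d × ((U × U) × (U × U)) → Pt d × ((U × U) × (U × U)) :=
    Prod.map id (Prod.map Prod.swap Prod.swap)
  have hT : MeasurePreserving T P P :=
    (MeasurePreserving.id μ).prod
      (Measure.measurePreserving_swap.prod Measure.measurePreserving_swap)
  let q : Pt d × ((U × U) × (U × U)) → ℝ := fun o => inner ℝ (r₁ o - r₂ o) (v₁ o - v₂ o)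
  have hqm : Measurable q := (hr₁m.sub hr₂m).inner (hv₁m.sub hv₂m)
  have hqT : ∀ o, q (T o) = q o := by
    intro o
    change inner ℝ (r₂ o - r₁ o) (v₂ o - v₁ o) = inner ℝ (r₁ o - r₂ o) (v₁ o - v₂ o)
    rw [← neg_sub (r₁ o), ← neg_sub (v₁ o), inner_neg_neg]
  let A : Set (Pt d × ((U × U) × (U × U))) := {o | 0 ≤ q o}
  have hA : MeasurableSet A := measurableSet_le measurable_const hqm
  have hTA : T ⁻¹' A = A := by
    ext o
    change 0 ≤ q (T o) ↔ 0 ≤ q o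
    rw [hqT]
  -- The pairing of `{r₁, r₂}` with `{v₁, v₂}` with the larger sum of inner products couples `r₁`
  -- with `V` and `r₂` with `V'`.
  let V : Pt d × ((U × U) × (U × U)) → Pt d := fun o => if o ∈ A then v₁ o else v₂ o
  let V' : Pt d × ((U × U) × (U × U)) → Pt d := fun o => if o ∈ A then v₂ o else v₁ o
  have hVm : Measurable V := Measurable.ite hA hv₁m hv₂m
  have hVlaw : P.map (fun o => (o.1, V o)) = (μ.prod ν).map (fun q => (q.1, v q)) := by
    have h1 := map_ite_eq_of_swap hT hA hTA (f := fun o => (o.1, v₁ o))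
      (g := fun o => (o.1, v₂ o)) (measurable_fst.prodMk hv₁m) (measurable_fst.prodMk hv₂m)
      rfl
    have h2 : P.map (fun o => (o.1, v₁ o)) = (μ.prod ν).map (fun q => (q.1, v q)) := by
      rw [← m₃.map_eq, Measure.map_map (measurable_fst.prodMk hvm) m₃.measurable]
      rfl
    rw [← h2, ← h1]
    congr 1
    ext1 o
    by_cases ho : o ∈ A <;> simp [V, ho]
  have hV0 := hopt V hVm hVlaw
  have hsym : ∫ o, inner ℝ (r₂ o) (V' o) ∂P = ∫ o, inner ℝ (r₁ o) (V o) ∂P := by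
    have hVT : ∀ o, V' (T o) = V o := by
      intro o
      have : T o ∈ A ↔ o ∈ A := by rw [← Set.mem_preimage, hTA]
      by_cases ho : o ∈ A
      · simp only [V, V', this, ho, if_true]; rfl
      · simp only [V, V', this, ho, if_false]; rfl
    have hV'm : Measurable V' := Measurable.ite hA hv₂m hv₁m
    conv_lhs => rw [← hT.map_eq]
    rw [integral_map hT.measurable.aemeasurable (hr₂m.inner hV'm).aestronglyMeasurable]
    refine integral_congr_ae (Eventually.of_forall fun o => ?_)
    simp only [hVT]
    rfl
  have i₁₁ := integrable_inner_of_memLp hr₁ hv₁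
  have i₁₂ := integrable_inner_of_memLp hr₁ hv₂
  have i₂₁ := integrable_inner_of_memLp hr₂ hv₁
  have i₂₂ := integrable_inner_of_memLp hr₂ hv₂
  have z₁₁ : ∫ o, inner ℝ (r₁ o) (v₁ o) ∂P = 0 := integral_inner_indep_eq_zero hr hr0
    (q := Prod.fst) (q' := Prod.fst) measurePreserving_fst i₁₁
  have z₁₂ : ∫ o, inner ℝ (r₁ o) (v₂ o) ∂P = 0 := integral_inner_indep_eq_zero hr hr0
    (q := Prod.fst) (q' := Prod.snd) measurePreserving_fst i₁₂
  have z₂₁ : ∫ o, inner ℝ (r₂ o) (v₁ o) ∂P = 0 := integral_inner_indep_eq_zero hr hr0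
    (q := Prod.snd) (q' := Prod.fst) measurePreserving_snd i₂₁
  have z₂₂ : ∫ o, inner ℝ (r₂ o) (v₂ o) ∂P = 0 := integral_inner_indep_eq_zero hr hr0
    (q := Prod.snd) (q' := Prod.snd) measurePreserving_snd i₂₂
  have iq : Integrable q P := integrable_inner_of_memLp (hr₁.sub hr₂) (hv₁.sub hv₂)
  have hpt : ∀ o, |q o| = 2 * (inner ℝ (r₁ o) (V o) + inner ℝ (r₂ o) (V' o)) -
      (inner ℝ (r₁ o) (v₁ o) + inner ℝ (r₁ o) (v₂ o) +
        (inner ℝ (r₂ o) (v₁ o) + inner ℝ (r₂ o) (v₂ o))) := by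
    intro o
    have hqo : q o = inner ℝ (r₁ o) (v₁ o) - inner ℝ (r₁ o) (v₂ o) -
        (inner ℝ (r₂ o) (v₁ o) - inner ℝ (r₂ o) (v₂ o)) := by
      simp only [q, inner_sub_left, inner_sub_right]; ring
    by_cases ho : o ∈ A
    · rw [abs_of_nonneg ho, hqo]
      simp only [V, V', ho, if_true]; ring
    · rw [abs_of_neg (not_le.1 ho), hqo]
      simp only [V, V', ho, if_false]; ring
  have iV : Integrable (fun o => inner ℝ (r₁ o) (V o)) P := by
    have : (fun o => inner ℝ (r₁ o) (V o)) =
        A.piecewise (fun o => inner ℝ (r₁ o) (v₁ o)) (fun o => inner ℝ (r₁ o) (v₂ o)) := by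
      ext o
      by_cases ho : o ∈ A <;> simp [V, ho]
    rw [this]
    exact Integrable.piecewise hA i₁₁.integrableOn i₁₂.integrableOn
  have iV' : Integrable (fun o => inner ℝ (r₂ o) (V' o)) P := by
    have : (fun o => inner ℝ (r₂ o) (V' o)) =
        A.piecewise (fun o => inner ℝ (r₂ o) (v₂ o)) (fun o => inner ℝ (r₂ o) (v₁ o)) := by
      ext o
      by_cases ho : o ∈ A <;> simp [V', ho]
    rw [this]
    exact Integrable.piecewise hA i₂₂.integrableOn i₂₁.integrableOn
  have habs : ∫ o, |q o| ∂P ≤ 0 := by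
    have iVV' : Integrable (fun o => 2 * (inner ℝ (r₁ o) (V o) + inner ℝ (r₂ o) (V' o))) P :=
      (iV.add iV').const_mul 2
    have i₁ : Integrable (fun o => inner ℝ (r₁ o) (v₁ o) + inner ℝ (r₁ o) (v₂ o)) P := i₁₁.add i₁₂
    have i₂ : Integrable (fun o => inner ℝ (r₂ o) (v₁ o) + inner ℝ (r₂ o) (v₂ o)) P := i₂₁.add i₂₂
    have i₁₂' : Integrable (fun o => inner ℝ (r₁ o) (v₁ o) + inner ℝ (r₁ o) (v₂ o) +
        (inner ℝ (r₂ o) (v₁ o) + inner ℝ (r₂ o) (v₂ o))) P := i₁.add i₂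
    simp_rw [hpt]
    rw [integral_sub iVV' i₁₂', integral_const_mul, integral_add iV iV', integral_add i₁ i₂,
      integral_add i₁₁ i₁₂, integral_add i₂₁ i₂₂, z₁₁, z₁₂, z₂₁, z₂₂, hsym]
    linarith
  have habs0 : ∫ o, |q o| ∂P = 0 := habs.antisymm (integral_nonneg fun _ => abs_nonneg _)
  rw [integral_eq_zero_iff_of_nonneg (fun _ => abs_nonneg _) iq.abs] at habs0
  filter_upwards [habs0] with o ho
  exact abs_eq_zero.1 ho

end IndependentCopies

end Residual

/-! ### The Grassmannian section -/

section GrassmannianSection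

variable {d : ℕ} {μ : Measure (Pt d)} {S : Set (Measure (TBundle d))}

/-- The optimal plan of `exists_optimal_plan`, realized by random vectors `w` and `π` on `μ ⊗ du`. -/
theorem exists_optimal_pair (hS : S ⊆ fields μ) (hne : S.Nonempty) (hclosed : IsWClosed μ S)
    (hconvex : IsHorizontallyConvex S) {ζ : Measure (TBundle d)} (hζ : ζ ∈ fields μ) :
    ∃ w π : Pt d × unitInterval → Pt d, Measurable w ∧ Measurable π ∧
      (μ.prod (volume : Measure unitInterval)).map (fun q => (q.1, w q)) = ζ ∧
      (μ.prod (volume : Measure unitInterval)).map (fun q => (q.1, π q)) ∈ S ∧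
      ∀ {Ω : Type} [MeasurableSpace Ω] (P : Measure Ω) (X w' v : Ω → Pt d),
        Measurable X → Measurable w' → Measurable v →
        P.map (fun o => (X o, w' o)) = ζ → P.map (fun o => (X o, v o)) ∈ S →
        ∫ q, ‖w q - π q‖ ^ 2 ∂(μ.prod (volume : Measure unitInterval)) ≤
          ∫ o, ‖w' o - v o‖ ^ 2 ∂P := by
  have := hζ.1
  obtain ⟨π, hπ, hπS, hopt⟩ := exists_optimal_plan hS hne hclosed hconvex hζ
  set Q : Measure (TBundle d × unitInterval) := ζ.prod volume with hQ
  have hm : Measurable fun q : TBundle d × unitInterval => (q.1.1, (q.1.2, π q)) := by fun_prop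
  have := Measure.isProbabilityMeasure_map (μ := Q) hm.aemeasurable
  have hQζ : Q.map Prod.fst = ζ :=
    (measurePreserving_fst (μ := ζ) (ν := (volume : Measure unitInterval))).map_eq
  obtain ⟨g, hg, hgρ⟩ :=
    exists_map_prod_unitInterval_eq (Q.map fun q => (q.1.1, (q.1.2, π q)))
  have hfst : (Q.map fun q => (q.1.1, (q.1.2, π q))).fst = μ := by
    rw [Measure.fst, Measure.map_map measurable_fst hm, ← hζ.2.2]
    conv_rhs => rw [← hQζ, Measure.map_map measurable_fst measurable_fst]
    rfl
  rw [hfst] at hgρ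
  have hgm : Measurable fun q : Pt d × unitInterval => (q.1, g q) := measurable_fst.prodMk hg
  refine ⟨fun q => (g q).1, fun q => (g q).2, by fun_prop, by fun_prop, ?_, ?_, ?_⟩
  · have h1 := congrArg (Measure.map fun t : TBundle2 d => (t.1, t.2.1)) hgρ
    rw [Measure.map_map (by fun_prop) hgm, Measure.map_map (by fun_prop) hm] at h1
    exact h1.trans hQζ
  · have h1 := congrArg (Measure.map fun t : TBundle2 d => (t.1, t.2.2)) hgρ
    rw [Measure.map_map (by fun_prop) hgm, Measure.map_map (by fun_prop) hm] at h1
    exact h1.symm ▸ hπS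
  · intro Ω _ P X w' v hX hw' hv hw'ζ hvS
    refine le_of_eq_of_le ?_ (hopt P X w' v hX hw' hv hw'ζ hvS)
    have hc : Continuous fun t : TBundle2 d => ‖t.2.1 - t.2.2‖ ^ 2 := by fun_prop
    have h1 := congrArg (fun m => ∫ t, ‖t.2.1 - t.2.2‖ ^ 2 ∂m) hgρ
    rwa [integral_map hgm.aemeasurable hc.aestronglyMeasurable,
      integral_map hm.aemeasurable hc.aestronglyMeasurable] at h1

/-- First-order optimality: `π + t V` has law in `S` for all `t ≥ 0`, so it is not closer to `w` than
`π` is. -/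
theorem integral_inner_nonpos_of_optimal (hS : S ⊆ fields μ) (hconvex : IsHorizontallyConvex S)
    (hcone : IsCone S) {Ω : Type} [MeasurableSpace Ω] {P : Measure Ω} {X w π V : Ω → Pt d}
    (hX : Measurable X) (hw : Measurable w) (hπ : Measurable π) (hV : Measurable V)
    (hwμ : P.map (fun o => (X o, w o)) ∈ fields μ) (hπS : P.map (fun o => (X o, π o)) ∈ S)
    (hVS : P.map (fun o => (X o, V o)) ∈ S)
    (hopt : ∀ v : Ω → Pt d, Measurable v → P.map (fun o => (X o, v o)) ∈ S →
      ∫ o, ‖w o - π o‖ ^ 2 ∂P ≤ ∫ o, ‖w o - v o‖ ^ 2 ∂P) :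
    ∫ o, inner ℝ (w o - π o) (V o) ∂P ≤ 0 := by
  have hw2 := ((map_mem_fields_iff hX hw).1 hwμ).2.2.1
  have hπ2 := ((map_mem_fields_iff hX hπ).1 (hS hπS)).2.2.1
  have hV2 := ((map_mem_fields_iff hX hV).1 (hS hVS)).2.2.1
  refine integral_inner_nonpos_of_forall_le (hw2.sub hπ2) hV2 fun t ht => ?_
  have := hopt (fun o => π o + t • V o) (hπ.add (hV.const_smul t))
    (map_add_mem hS hconvex hcone hX hπ (hV.const_smul t) hπS (map_smul_mem hcone hX hV hVS ht))
  simpa only [sub_sub, Pi.sub_apply] using this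

/-- The residual `w - π` of an optimal pair is almost surely orthogonal to the fibrewise second
moment matrix of every `v` with law in `S`. -/
theorem ae_inner_integral_coord_smul_eq_zero (hcentred : S ⊆ centredFields μ)
    (hconvex : IsHorizontallyConvex S) (hcone : IsCone S) {ζ : Measure (TBundle d)}
    (hζ : ζ ∈ centredFields μ) {w π v : Pt d × unitInterval → Pt d} (hw : Measurable w)
    (hπ : Measurable π) (hv : Measurable v)
    (hwζ : (μ.prod (volume : Measure unitInterval)).map (fun q => (q.1, w q)) = ζ)
    (hπS : (μ.prod (volume : Measure unitInterval)).map (fun q => (q.1, π q)) ∈ S)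
    (hvS : (μ.prod (volume : Measure unitInterval)).map (fun q => (q.1, v q)) ∈ S)
    (hopt : ∀ {Ω : Type} [MeasurableSpace Ω] (P : Measure Ω) (X w' v : Ω → Pt d),
        Measurable X → Measurable w' → Measurable v →
        P.map (fun o => (X o, w' o)) = ζ → P.map (fun o => (X o, v o)) ∈ S →
        ∫ q, ‖w q - π q‖ ^ 2 ∂(μ.prod (volume : Measure unitInterval)) ≤
          ∫ o, ‖w' o - v o‖ ^ 2 ∂P) (i : Fin d) :
    ∀ᵐ q ∂(μ.prod (volume : Measure unitInterval)),
      inner ℝ (w q - π q) (∫ u, v (q.1, u) i • v (q.1, u)) = 0 := by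
  have hS : S ⊆ fields μ := fun ξ hξ => (hcentred hξ).1
  have := isProbabilityMeasure_of_mem_fields hζ.1
  set ν : Measure unitInterval := volume with hν
  have hw2 := ((map_mem_fields_iff measurable_fst hw).1 (hwζ.symm ▸ hζ.1)).2.2.1
  have hπ2 := ((map_mem_fields_iff measurable_fst hπ).1 (hS hπS)).2.2.1
  have hv2 := ((map_mem_fields_iff measurable_fst hv).1 (hS hvS)).2.2.1
  have hw0 := ae_integral_eq_zero_of_map_mem_centredFields hw (hwζ.symm ▸ hζ)
  have hπ0 := ae_integral_eq_zero_of_map_mem_centredFields hπ (hcentred hπS)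
  have hv0 := ae_integral_eq_zero_of_map_mem_centredFields hv (hcentred hvS)
  have hwI := (hw2.integrable (by norm_num)).prod_right_ae
  have hπI := (hπ2.integrable (by norm_num)).prod_right_ae
  have hr0 : ∀ᵐ x ∂μ, ∫ u, (w - π) (x, u) ∂ν = 0 := by
    filter_upwards [hw0, hπ0, hwI, hπI] with x h1 h2 h3 h4
    simp only [Pi.sub_apply]
    rw [integral_sub h3 h4, h1, h2, sub_zero]
  have hvsq := (hv2.integrable_norm_pow two_ne_zero).prod_right_ae
  have hpair := ae_inner_sub_sub_eq_zero (hw.sub hπ) hv (hw2.sub hπ2) hv2 hr0 (ν := ν)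
    fun V hV hVlaw => by
      have m₁ : MeasurePreserving (Prod.map id (Prod.fst ∘ Prod.fst))
          (μ.prod ((ν.prod ν).prod (ν.prod ν))) (μ.prod ν) :=
        (MeasurePreserving.id μ).prod ((measurePreserving_fst (μ := ν) (ν := ν)).comp
          (measurePreserving_fst (μ := ν.prod ν) (ν := ν.prod ν)))
      have hw₁ : (μ.prod ((ν.prod ν).prod (ν.prod ν))).map (fun o => (o.1, w (o.1, o.2.1.1)))
          = ζ := by
        rw [← hwζ, ← m₁.map_eq, Measure.map_map (measurable_fst.prodMk hw) m₁.measurable]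
        rfl
      have hπ₁ : (μ.prod ((ν.prod ν).prod (ν.prod ν))).map (fun o => (o.1, π (o.1, o.2.1.1)))
          ∈ S := by
        rw [← m₁.map_eq, Measure.map_map (measurable_fst.prodMk hπ) m₁.measurable] at hπS
        exact hπS
      refine integral_inner_nonpos_of_optimal hS hconvex hcone measurable_fst
        (hw.comp m₁.measurable) (hπ.comp m₁.measurable) hV (hw₁.symm ▸ hζ.1) hπ₁
        (hVlaw ▸ hvS) fun v' hv' hv'S => ?_
      refine le_of_eq_of_le ?_
        (hopt _ _ _ v' measurable_fst (hw.comp m₁.measurable) hv' hw₁ hv'S)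
      have hn : Measurable fun q => ‖w q - π q‖ ^ 2 := (hw.sub hπ).norm.pow_const 2
      conv_rhs => rw [← m₁.map_eq]
      rw [integral_map m₁.measurable.aemeasurable hn.aestronglyMeasurable]
      rfl
  have hF : Measurable fun x => ∫ u, v (x, u) i • v (x, u) ∂ν := by
    have : Measurable fun q => v q i • v q := by fun_prop
    exact (this.stronglyMeasurable.integral_prod_right').measurable
  have hmeas : MeasurableSet {q : Pt d × unitInterval |
      inner ℝ (w q - π q) (∫ u, v (q.1, u) i • v (q.1, u) ∂ν) = 0} :=
    ((hw.sub hπ).inner (hF.comp measurable_fst)) (measurableSet_singleton 0)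
  rw [Measure.ae_prod_iff_ae_ae hmeas]
  filter_upwards [Measure.ae_ae_of_ae_prod hpair, hr0, hv0, hwI, hπI, hvsq]
    with x hx h1 h2 h3 h4 h5
  have hvx : MemLp (fun u => v (x, u)) 2 ν :=
    (memLp_two_iff_integrable_sq_norm
      (hv.comp measurable_prodMk_left).aestronglyMeasurable).2 h5
  exact ae_inner_integral_eq_zero (h3.sub h4) hvx h1 h2 hx i

/-- Representatives of elements of `S` on `μ ⊗ du` form a subset of a separable `L²` space, so a
sequence of them is dense; passing to subsequences gives almost sure convergence. -/
theorem exists_seq_forall_exists_ae_tendsto (hS : S ⊆ fields μ) (hne : S.Nonempty) :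
    ∃ V : ℕ → Pt d × unitInterval → Pt d, (∀ n, Measurable (V n)) ∧
      (∀ n, (μ.prod (volume : Measure unitInterval)).map (fun q => (q.1, V n q)) ∈ S) ∧
      ∀ v : Pt d × unitInterval → Pt d, Measurable v →
        (μ.prod (volume : Measure unitInterval)).map (fun q => (q.1, v q)) ∈ S →
        ∃ φ : ℕ → ℕ, ∀ᵐ q ∂(μ.prod (volume : Measure unitInterval)),
          Tendsto (fun n => V (φ n) q) atTop (𝓝 (v q)) := by
  set Q : Measure (Pt d × unitInterval) := μ.prod volume with hQ
  have : IsProbabilityMeasure μ := isProbabilityMeasure_of_mem_fields (hS hne.some_mem)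
  have : Fact ((2 : ℝ≥0∞) ≠ ∞) := ⟨by norm_num⟩
  have : IsProbabilityMeasure Q := by rw [hQ]; infer_instance
  let K : Set (Lp (Pt d) 2 Q) := {f | Q.map (fun q => (q.1, f q)) ∈ S}
  have hmeas : ∀ f : Lp (Pt d) 2 Q, Measurable f := fun f => (Lp.stronglyMeasurable f).measurable
  have hK : ∀ {v : Pt d × unitInterval → Pt d}, Measurable v →
      Q.map (fun q => (q.1, v q)) ∈ S → ∃ f ∈ K, f =ᵐ[Q] v := by
    intro v hv hvS
    have hv2 := ((map_mem_fields_iff measurable_fst hv).1 (hS hvS)).2.2.1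
    refine ⟨hv2.toLp v, ?_, hv2.coeFn_toLp⟩
    have : Q.map (fun q => (q.1, hv2.toLp v q)) = Q.map (fun q => (q.1, v q)) := by
      refine Measure.map_congr ?_
      filter_upwards [hv2.coeFn_toLp] with q hq
      rw [hq]
    change Q.map (fun q => (q.1, hv2.toLp v q)) ∈ S
    rwa [this]
  have : Nonempty K := by
    obtain ⟨v, hv, hvξ⟩ := exists_map_prod_unitInterval_eq_of_mem_fields (hS hne.some_mem)
    obtain ⟨f, hf, -⟩ := hK hv (hvξ ▸ hne.some_mem)
    exact ⟨⟨f, hf⟩⟩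
  have : MeasurableSpace.CountablyGenerated (Pt d × unitInterval) :=
    inferInstance
  have : SecondCountableTopology (Lp (Pt d) 2 Q) := Lp.SecondCountableTopology
  let s : ℕ → K := TopologicalSpace.denseSeq K
  refine ⟨fun n => (s n : Lp (Pt d) 2 Q), fun n => hmeas _, fun n => (s n).2,
    fun v hv hvS => ?_⟩
  obtain ⟨f, hfK, hfv⟩ := hK hv hvS
  have hcl : (⟨f, hfK⟩ : K) ∈ closure (Set.range s) := TopologicalSpace.denseRange_denseSeq K _
  obtain ⟨t, ht, htlim⟩ := mem_closure_iff_seq_limit.1 hcl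
  choose φ hφ using ht
  have hlim : Tendsto (fun n => (s (φ n) : Lp (Pt d) 2 Q)) atTop (𝓝 f) := by
    simp only [hφ]
    exact (continuous_subtype_val.tendsto _).comp htlim
  obtain ⟨ns, -, hns⟩ := (tendstoInMeasure_of_tendsto_Lp hlim).exists_seq_tendsto_ae
  refine ⟨φ ∘ ns, ?_⟩
  filter_upwards [hns, hfv] with q h1 h2
  rw [← h2]
  exact h1

end GrassmannianSection

end MeasureField

theorem mainTheorem4 (d : ℕ) (hd : 1 ≤ d) (μ : Measure (MeasureField.Pt d))
    (hμ : μ ∈ MeasureField.P2 d)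
    (S : Set (Measure (MeasureField.TBundle d)))
    (hne : S.Nonempty)
    (hcentred : S ⊆ MeasureField.centredFields μ)
    (hclosed : MeasureField.IsWClosed μ S)
    (hconvex : MeasureField.IsHorizontallyConvex S)
    (hcone : MeasureField.IsCone S) :
    ∃ D : MeasureField.Pt d → Submodule ℝ (MeasureField.Pt d),
      MeasureField.IsGrassmannianSection D ∧
        ∀ ξ : Measure (MeasureField.TBundle d),
          ξ ∈ S ↔ (ξ ∈ MeasureField.centredFields μ ∧ ξ (MeasureField.graph D) = 1) := by
  open MeasureField in
  have hS : S ⊆ fields μ := fun ξ hξ => (hcentred hξ).1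
  have := hμ.1
  obtain ⟨V, hV, hVS, hVdense⟩ := exists_seq_forall_exists_ae_tendsto hS hne
  let F : ℕ × Fin d → Pt d → Pt d := fun k x => ∫ u : unitInterval, V k.1 (x, u) k.2 • V k.1 (x, u)
  have hF : ∀ k, Measurable (F k) := fun k => by
    have h := hV k.1
    have : Measurable fun q => V k.1 q k.2 • V k.1 q := by fun_prop
    exact (this.stronglyMeasurable.integral_prod_right').measurable
  let D : Pt d → Submodule ℝ (Pt d) := fun x => Submodule.span ℝ (Set.range fun k => F k x)
  have hDg : MeasurableSet (graph D) := measurableSet_mem_span hF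
  have hgraph : ∀ {v : Pt d × unitInterval → Pt d}, Measurable v →
      ((μ.prod volume).map (fun q => (q.1, v q)) (graph D) = 1 ↔
        ∀ᵐ q ∂(μ.prod volume), v q ∈ D q.1) := by
    intro v hv
    have hm : Measurable fun q : Pt d × unitInterval => (q.1, v q) := measurable_fst.prodMk hv
    rw [Measure.map_apply hm hDg, ← mem_ae_iff_prob_eq_one (hm hDg)]
    rfl
  have hVD : ∀ n, ∀ᵐ q ∂(μ.prod (volume : Measure unitInterval)), V n q ∈ D q.1 := by
    intro n
    have hV2 := ((map_mem_fields_iff measurable_fst (hV n)).1 (hS (hVS n))).2.2.1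
    have hm : MeasurableSet {q : Pt d × unitInterval | V n q ∈ D q.1} :=
      (measurable_fst.prodMk (hV n)) hDg
    rw [Measure.ae_prod_iff_ae_ae hm]
    filter_upwards [(hV2.integrable_norm_pow two_ne_zero).prod_right_ae] with x hx
    have hx2 : MemLp (fun u => V n (x, u)) 2 volume :=
      (memLp_two_iff_integrable_sq_norm
        ((hV n).comp measurable_prodMk_left).aestronglyMeasurable).2 hx
    filter_upwards [ae_mem_span_integral_coord_smul hx2] with u hu
    refine Submodule.span_mono ?_ hu
    rintro _ ⟨i, rfl⟩
    exact ⟨(n, i), rfl⟩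
  have hSD : ∀ {v : Pt d × unitInterval → Pt d}, Measurable v →
      (μ.prod volume).map (fun q => (q.1, v q)) ∈ S →
      ∀ᵐ q ∂(μ.prod volume), v q ∈ D q.1 := by
    intro v hv hvS
    obtain ⟨φ, hφ⟩ := hVdense v hv hvS
    filter_upwards [hφ, ae_all_iff.2 hVD] with q h1 h2
    exact (D q.1).closed_of_finiteDimensional.mem_of_tendsto h1
      (Eventually.of_forall fun n => h2 (φ n))
  refine ⟨D, fun O hO => measurableSet_span_inter_nonempty hF hO, fun ζ => ⟨fun hζ => ?_, ?_⟩⟩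
  · refine ⟨hcentred hζ, ?_⟩
    obtain ⟨v, hv, hvζ⟩ := exists_map_prod_unitInterval_eq_of_mem_fields (hS hζ)
    rw [← hvζ] at hζ ⊢
    exact (hgraph hv).2 (hSD hv hζ)
  · rintro ⟨hζ, hζD⟩
    obtain ⟨w, π, hw, hπ, hwζ, hπS, hopt⟩ :=
      exists_optimal_pair hS hne hclosed hconvex hζ.1
    have hwD := (hgraph hw).1 (hwζ ▸ hζD)
    have hπD := hSD hπ hπS
    have horth := ae_all_iff.2 fun k : ℕ × Fin d =>
      ae_inner_integral_coord_smul_eq_zero hcentred hconvex hcone hζ hw hπ (hV k.1) hwζ hπS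
        (hVS k.1) hopt k.2
    have hwπ : ∀ᵐ q ∂(μ.prod (volume : Measure unitInterval)), w q = π q := by
      filter_upwards [hwD, hπD, horth] with q h1 h2 h3
      have hle : D q.1 ≤ (ℝ ∙ (w q - π q))ᗮ := by
        refine Submodule.span_le.2 ?_
        rintro _ ⟨k, rfl⟩
        exact Submodule.mem_orthogonal_singleton_iff_inner_right.2 (h3 k)
      have := Submodule.mem_orthogonal_singleton_iff_inner_right.1 (hle ((D q.1).sub_mem h1 h2))
      exact sub_eq_zero.1 (inner_self_eq_zero.1 this)
    have : (μ.prod volume).map (fun q : Pt d × unitInterval => (q.1, w q)) =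
        (μ.prod volume).map (fun q => (q.1, π q)) := by
      refine Measure.map_congr ?_
      filter_upwards [hwπ] with q hq
      rw [hq]
    rw [← hwζ, this]
    exact hπS
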